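/- Let $F$ be a $(\sigma,\partial)$-field, i.e. a field of characteristic zero equipped with a field automorphism $\sigma$ and a derivation $\partial$ such that $\sigma\partial=\partial\sigma$. (No assumption is made on the field $K=F^\sigma$ of $\sigma$-invariant elements.) Let $A\in GL_\nu(F)$. Then there exists a $(\sigma,\partial)$-extension $R^\#$ of $F$, i.e. a commutative ring $R^\#\supseteq F$ equipped with a ring automorphism $\sigma$ and a derivation $\partial$ that extend those of $F$ and satisfy $\sigma\partial=\partial\sigma$ on $R^\#$, such that: 1. there is a matrix $Z\in GL_\nu(R^\#)$ with $\sigma(Z)=AZ$ (where $\sigma$ is applied entrywise) such that $R^\#$ is generated over $F$ as a $\partial$-ring by the entries of $Z$ and $\frac{1}{\det Z}$; that is, the only $F$-subalgebra of $R^\#$ which is stable under $\partial$ and contains the entries of $Z$ and $\frac{1}{\det Z}$ is $R^\#$ itself; 2. $R^\#$ is a simple $\sigma$-ring; that is, $R^\#\neq 0$ and the only ideals $I$ of $R^\#$ with $\sigma(I)\subseteq I$ are $0$ and $R^\#$. -/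

import Mathlib

universe u

/-- A commutative `(σ, ∂)`-ring: a commutative ring with a derivation `∂` (Mathlib's
`Differential` structure) and a ring automorphism `σ` such that `σ ∂ = ∂ σ`. -/
class SigmaDelRing (R : Type*) [CommRing R] extends Differential R where
  /-- The automorphism `σ`. -/
  sigma : R ≃+* R
  sigma_deriv : ∀ x : R, sigma (deriv x) = deriv (sigma x)

/-- `R` is a `(σ, ∂)`-extension of `F`: a ring extension of `F` whose `σ` and `∂` extend
those of `F`. -/
structure IsSigmaDelExtension (F R : Type*) [CommRing F] [SigmaDelRing F]
    [CommRing R] [SigmaDelRing R] [Algebra F R] : Prop where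
  injective : Function.Injective (algebraMap F R)
  sigma_algebraMap : ∀ a : F,
    SigmaDelRing.sigma (algebraMap F R a) = algebraMap F R (SigmaDelRing.sigma a)
  deriv_algebraMap : ∀ a : F,
    Differential.deriv (algebraMap F R a) = algebraMap F R (Differential.deriv a)

/-- A simple `σ`-ring: a nonzero ring whose only ideals `I` with `σ(I) ⊆ I` are the zero ideal
and the whole ring. -/
structure IsSimpleSigmaRing (R : Type*) [CommRing R] [SigmaDelRing R] : Prop where
  nontrivial : Nontrivial R
  eq_bot_or_eq_top : ∀ I : Ideal R,
    (∀ x ∈ I, SigmaDelRing.sigma x ∈ I) → I = ⊥ ∨ I = ⊤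

/-- The `∂`-ring generated over `F` by a set `s`: the smallest `F`-subalgebra of `R` that
contains `s` and is stable under `∂`. -/
def delAdjoin (F : Type*) {R : Type*} [CommRing F] [CommRing R] [Differential R] [Algebra F R]
    (s : Set R) : Subalgebra F R :=
  sInf {S : Subalgebra F R | s ⊆ S ∧ ∀ x ∈ S, Differential.deriv x ∈ S}

/-- The set consisting of the entries of an invertible matrix `Z` and of `1 / det Z`. -/
def entriesAndInvDet {R : Type*} [CommRing R] {n : ℕ} (Z : GL (Fin n) R) : Set R :=
  {x : R | ∃ i j, x = Z i j} ∪ {((Matrix.GeneralLinearGroup.det Z)⁻¹ : Rˣ).val}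

/-- `Z` is a fundamental solution matrix of the difference system `σ(Y) = A Y`
with `A ∈ GL_n(F)`: it is invertible and satisfies `σ(Z) = A Z`. -/
def IsFundamentalSolution {F R : Type*} [CommRing F] [CommRing R] [SigmaDelRing R] [Algebra F R]
    {n : ℕ} (A : GL (Fin n) F) (Z : GL (Fin n) R) : Prop :=
  Z.val.map (SigmaDelRing.sigma : R ≃+* R) = A.val.map (algebraMap F R) * Z.val

-- Extending derivations in characteristic zero

universe v w

/-! Let `S` be the ring of differential polynomials in the entries of `Y` and a further unknown for
`1 / det Y`, with `σ(Y) = A Y`. The ring sought is `S ⧸ m` for a `∂`-stable ideal `m` that is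
maximal among all proper `σ`-ideals. A maximal ideal stable under both operators would only give
simplicity for the pair, so `m` is built order by order.

Let `T d` be the polynomials of order `< d`. Maximal `σ`-ideals `I d` of `T d` are chosen with `I d
∪ ∂(I d) ⊆ I (d + 1)`, and `m` is their union. The crux is `exists_prolongation`: `I (d + 1)` and
its derivatives generate a proper ideal of `T (d + 2)`. Maximality makes `I d` radical and equal to
`I (d + 1) ∩ T d`. Hence `∂` passes to a derivation from the quotient of `T d` by a minimal prime
over `I d` to a field `L` that is a quotient field of `T (d + 1)` modulo a prime
(`exists_field_derivation`). In characteristic zero it extends to `L`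
(`exists_derivation_extension`), and its values there give a zero in `L` of the prolonged ideal. No
constants enter the argument. -/

theorem Algebra.FormallySmooth.of_field_charZero (K : Type u) (L : Type v) [Field K] [Field L]
    [CharZero K] [Algebra K L] : Algebra.FormallySmooth K L := by
  obtain ⟨s, hs⟩ := exists_isTranscendenceBasis K L
  have := hs.isAlgebraic_field
  exact .of_algebraicIndependent_of_isSeparable hs.1

/-- If `L` is formally smooth over `B`, a ring homomorphism from `B` to an infinitesimal
thickening `C` of `L` extends to `L`. -/
theorem Algebra.FormallySmooth.exists_ringHom_lift {B : Type u} {L : Type v} {C : Type w}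
    [CommRing B] [CommRing L] [CommRing C] [Algebra B L] [Algebra.FormallySmooth B L]
    (θ : B →+* C) (π : C →+* L) (hπ : Function.Surjective π) (hk : IsNilpotent (RingHom.ker π))
    (h : ∀ b, π (θ b) = algebraMap B L b) :
    ∃ Θ : L →+* C, (∀ b, Θ (algebraMap B L b) = θ b) ∧ ∀ x, π (Θ x) = x := by
  let := θ.toAlgebra
  let g : C →ₐ[B] L := { π with commutes' := h }
  let f := Algebra.FormallySmooth.liftOfSurjective (AlgHom.id B L) g hπ hk
  exact ⟨f, fun b => f.commutes b,
    fun x => Algebra.FormallySmooth.liftOfSurjective_apply (AlgHom.id B L) g hπ hk x⟩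

/-- The homomorphism to the dual numbers given by a derivation along a ring homomorphism. -/
def TrivSqZeroExt.ringHomOfLeibniz {A : Type u} {L : Type v} [CommRing A] [CommRing L]
    (f : A →+* L) (d : A →+ L) (hd : ∀ x y, d (x * y) = f x * d y + f y * d x) :
    A →+* TrivSqZeroExt L L where
  toFun a := TrivSqZeroExt.inl (f a) + TrivSqZeroExt.inr (d a)
  map_one' := by
    have : d 1 = 0 := by simpa using hd 1 1
    ext <;> simp [this]
  map_zero' := by ext <;> simp
  map_add' x y := by ext <;> simp only [map_add, TrivSqZeroExt.fst_add, TrivSqZeroExt.snd_add,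
    TrivSqZeroExt.fst_inl, TrivSqZeroExt.fst_inr, TrivSqZeroExt.snd_inl, TrivSqZeroExt.snd_inr,
    add_zero, zero_add]
  map_mul' x y := by ext <;> simp [hd, mul_comm (f y)]

/-- The derivation of a ring given by an additive map satisfying the Leibniz rule. -/
def Derivation.ofLeibniz {R : Type u} [CommRing R] (f : R →+ R)
    (h : ∀ a b, f (a * b) = a * f b + b * f a) : Derivation ℤ R R :=
  Derivation.mk' (AddMonoidHom.toIntLinearMap f) h

/-- In characteristic zero, a derivation along a ring homomorphism to a field that vanishes on
the kernel extends to a derivation of the field. -/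
theorem exists_derivation_extension {A : Type u} {L : Type v} [CommRing A] [Field L] [CharZero L]
    (f : A →+* L) (d : A →+ L) (hd : ∀ x y, d (x * y) = f x * d y + f y * d x)
    (hker : ∀ x, f x = 0 → d x = 0) :
    ∃ D : Derivation ℤ L L, ∀ a, D (f a) = d a := by
  let B := A ⧸ RingHom.ker f
  have hinj := RingHom.kerLift_injective f
  let : Algebra B L := (RingHom.kerLift f).toAlgebra
  have : FaithfulSMul B L := (faithfulSMul_iff_algebraMap_injective _ _).2 hinj
  have : IsDomain B := hinj.isDomain
  let : Algebra (FractionRing B) L := FractionRing.liftAlgebra _ _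
  have : CharZero (FractionRing B) :=
    ⟨fun a b hab => by
      have := congrArg (algebraMap (FractionRing B) L) hab
      simpa using this⟩
  have := Algebra.FormallySmooth.of_field_charZero (FractionRing B) L
  have : Algebra.FormallySmooth B (FractionRing B) := .of_isLocalization (nonZeroDivisors B)
  have : Algebra.FormallySmooth B L := .comp _ (FractionRing B) _
  -- A derivation of `L` is a ring section `x ↦ x + ε D x` of the dual numbers over `L`; formal
  -- smoothness lifts the one prescribed on `B`.
  let θ₀ := TrivSqZeroExt.ringHomOfLeibniz f d hd
  let θ : B →+* TrivSqZeroExt L L := Ideal.Quotient.lift _ θ₀ fun a ha => by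
    have : f a = 0 := ha
    simp [θ₀, TrivSqZeroExt.ringHomOfLeibniz, this, hker a this]
  obtain ⟨Θ, h1, h2⟩ := Algebra.FormallySmooth.exists_ringHom_lift θ
    (TrivSqZeroExt.fstHom L L L : TrivSqZeroExt L L →+* L) TrivSqZeroExt.fst_surjective
    ⟨2, TrivSqZeroExt.kerIdeal_sq L L⟩ fun b => by
      obtain ⟨a, rfl⟩ := Ideal.Quotient.mk_surjective b
      change (θ₀ a).fst = f a
      simp [θ₀, TrivSqZeroExt.ringHomOfLeibniz]
  have h2' : ∀ x, (Θ x).fst = x := h2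
  refine ⟨.ofLeibniz ((TrivSqZeroExt.sndHom L L).toAddMonoidHom.comp Θ.toAddMonoidHom)
    fun a b => ?_, fun a => ?_⟩
  · simp [h2', mul_comm]
  · have h3 : Θ (f a) = θ₀ a := h1 (Ideal.Quotient.mk _ a)
    change (Θ (f a)).snd = _
    rw [h3]
    simp [θ₀, TrivSqZeroExt.ringHomOfLeibniz]

/-- In the localization at `q` the radical of the extension of `I` is the extension of `q`. So `s *
x ^ k ∈ I` for some `s ∉ q`, and radicality removes the exponent. -/
theorem Ideal.exists_notMem_mul_mem_of_mem_minimalPrimes {A : Type u} [CommRing A] {I q : Ideal A}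
    (hI : I.IsRadical) (hq : q ∈ I.minimalPrimes) {x : A} (hx : x ∈ q) :
    ∃ s ∉ q, s * x ∈ I := by
  have := hq.isPrime
  have h := Ideal.mem_map_of_mem (algebraMap A (Localization.AtPrime q)) hx
  rw [← IsLocalization.AtPrime.radical_map_of_mem_minimalPrimes
    (A := Localization.AtPrime q) q I hq] at h
  obtain ⟨k, hk⟩ := h
  rw [← map_pow, IsLocalization.algebraMap_mem_map_algebraMap_iff q.primeCompl] at hk
  obtain ⟨s, hs, hsx⟩ := hk
  refine ⟨s, hs, hI ⟨k + 1, ?_⟩⟩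
  rw [show (s * x) ^ (k + 1) = s ^ k * x * (s * x ^ k) by ring]
  exact I.mul_mem_left _ hsx

/-- A derivation `δ` along a ring homomorphism `ι : A → B` that maps a radical ideal `m = n ∩ A`
to `n` is induced by a derivation of a field `L` along some homomorphism `B → L` that kills
`n`. -/
theorem exists_field_derivation {A : Type u} {B : Type v} [CommRing A] [CommRing B] [Algebra ℚ B]
    (ι : A →+* B) (δ : A →+ B) (hδ : ∀ x y, δ (x * y) = ι x * δ y + ι y * δ x)
    {m : Ideal A} {n : Ideal B} (hm : m.IsRadical) (hmt : m ≠ ⊤) (hmn : n.comap ι = m)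
    (hδm : ∀ x ∈ m, δ x ∈ n) :
    ∃ (L : Type v) (_ : Field L) (φ : B →+* L) (D : Derivation ℤ L L),
      (∀ x ∈ n, φ x = 0) ∧ ∀ a, D (φ (ι a)) = φ (δ a) := by
  obtain ⟨q, hq⟩ := Ideal.nonempty_minimalPrimes hmt
  -- A minimal prime over a contracted ideal is itself the contraction of a prime containing `n`.
  obtain ⟨P, hP, hnP, rfl⟩ := Ideal.exists_comap_eq_of_mem_minimalPrimes ι q (by rwa [hmn])
  -- Differentiate `s * x ∈ m` with `s ∉ q`: modulo `P` only `ι s * δ x` remains, and `ι s ∉ P`.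
  have hδq : ∀ x, ι x ∈ P → δ x ∈ P := by
    intro x hx
    obtain ⟨s, hs, hsx⟩ := Ideal.exists_notMem_mul_mem_of_mem_minimalPrimes hm hq (x := x) hx
    have h1 := hnP (hδm _ hsx)
    rw [hδ] at h1
    have h2 := (P.add_mem_iff_left (P.mul_mem_right (δ s) hx)).1 h1
    exact (hP.mem_or_mem h2).resolve_left hs
  let L := FractionRing (B ⧸ P)
  let φ : B →+* L := (algebraMap (B ⧸ P) L).comp (Ideal.Quotient.mk P)
  have hφ : ∀ x, φ x = 0 ↔ x ∈ P := fun x => by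
    simp [φ, L, Ideal.Quotient.eq_zero_iff_mem]
  have : CharZero L := by
    let := (φ.comp (algebraMap ℚ B)).toAlgebra
    exact algebraRat.charZero L
  obtain ⟨D, hD⟩ := exists_derivation_extension (φ.comp ι) (φ.toAddMonoidHom.comp δ)
    (fun x y => by simp [hδ]) fun x hx => (hφ _).2 (hδq x ((hφ _).1 hx))
  exact ⟨L, inferInstance, φ, D, fun x hx => (hφ x).2 (hnP hx), hD⟩

/-! ### Maximal proper `σ`-ideals -/

/-- Maximal elements among the proper ideals that are mapped to themselves by `σ`. -/
structure Ideal.IsMaximalStable {R : Type u} [CommRing R] (σ : R →+* R) (I : Ideal R) : Prop where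
  ne_top : I ≠ ⊤
  stable : I ≤ I.comap σ
  eq_or_eq_top : ∀ J : Ideal R, J ≤ J.comap σ → I ≤ J → J = I ∨ J = ⊤

theorem Ideal.exists_le_isMaximalStable {R : Type u} [CommRing R] (σ : R →+* R) (I : Ideal R)
    (hI : I ≠ ⊤) (hσ : I ≤ I.comap σ) : ∃ J, I ≤ J ∧ J.IsMaximalStable σ := by
  obtain ⟨J, hIJ, hJ⟩ := zorn_le_nonempty₀ {J : Ideal R | J ≠ ⊤ ∧ J ≤ J.comap σ} (by
    intro c hc hchain y hy
    refine ⟨sSup c, ⟨?_, ?_⟩, fun z hz => le_sSup hz⟩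
    · rw [Ideal.ne_top_iff_one, Submodule.mem_sSup_of_directed ⟨y, hy⟩ hchain.directedOn]
      rintro ⟨z, hz, h1⟩
      exact (hc hz).1 ((Ideal.eq_top_iff_one _).2 h1)
    · exact sSup_le fun z hz => (hc hz).2.trans (Ideal.comap_mono (le_sSup hz))) I ⟨hI, hσ⟩
  refine ⟨J, hIJ, hJ.prop.1, hJ.prop.2, fun J' hJ' hle => ?_⟩
  by_cases h : J' = ⊤
  · exact .inr h
  · exact .inl (le_antisymm (hJ.le_of_ge ⟨h, hJ'⟩ hle) hle)

theorem Ideal.IsMaximalStable.isRadical {R : Type u} [CommRing R] {σ : R →+* R} {I : Ideal R}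
    (hI : I.IsMaximalStable σ) : I.IsRadical := by
  have h : I.radical ≤ I.radical.comap σ := by
    rw [Ideal.comap_radical]
    exact Ideal.radical_mono hI.stable
  rcases hI.eq_or_eq_top _ h Ideal.le_radical with h | h
  · exact Ideal.radical_eq_iff.1 h
  · exact absurd (Ideal.radical_eq_top.1 h) hI.ne_top

/-- Contractions of proper `σ`-ideals are proper `σ`-ideals. This makes the ideals chosen at
successive orders contract to one another. -/
theorem Ideal.IsMaximalStable.comap_eq {A : Type u} {B : Type v} [CommRing A] [CommRing B]
    {σ : A →+* A} {τ : B →+* B} {I : Ideal A} (hI : I.IsMaximalStable σ) (f : A →+* B)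
    (hf : ∀ x, f (σ x) = τ (f x)) {J : Ideal B} (hJ : J ≤ J.comap τ) (hJt : J ≠ ⊤)
    (h : I ≤ J.comap f) : J.comap f = I := by
  refine (hI.eq_or_eq_top _ (fun x hx => ?_) h).resolve_right ?_
  · change f (σ x) ∈ J
    rw [hf]
    exact hJ hx
  · rwa [Ideal.comap_eq_top_iff]

/-! ### Prolongation of `σ`-ideals along the order filtration -/

/-- A filtration `T 0 ⊆ T 1 ⊆ …` of a `(σ, ∂)`-algebra `S` by `σ`-stable subalgebras with
`∂ (T d) ⊆ T (d + 1)`, such that `∂` on `T (d + 1)` is free except for its values on `T d`. -/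
structure IsDelFiltration {F S : Type u} [Field F] [CommRing S] [Algebra F S] (σ : S →+* S)
    (δ : Derivation ℤ S S) (T : ℕ → Subalgebra F S) : Prop where
  mono : Monotone T
  exists_mem : ∀ x, ∃ d, x ∈ T d
  zero_eq_bot : T 0 = ⊥
  sigma_del : ∀ x, σ (δ x) = δ (σ x)
  sigma_mem : ∀ {d x}, x ∈ T d → σ x ∈ T d
  del_mem : ∀ {d x}, x ∈ T d → δ x ∈ T (d + 1)
  exists_extension : ∀ (d : ℕ) (L : Type u) [Field L] (φ : T (d + 1) →+* L)
    (D : Derivation ℤ L L),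
    (∀ x (hx : x ∈ T d), D (φ ⟨x, mono (Nat.le_succ d) hx⟩) = φ ⟨δ x, del_mem hx⟩) →
    ∃ ψ : S →+* L, ∀ x (hx : x ∈ T (d + 1)), ψ x = φ ⟨x, hx⟩ ∧ ψ (δ x) = D (φ ⟨x, hx⟩)

namespace IsDelFiltration

variable {F S : Type u} [Field F] [CommRing S] [Algebra F S] {σ : S →+* S}
  {δ : Derivation ℤ S S} {T : ℕ → Subalgebra F S} (h : IsDelFiltration σ δ T)

include h

/-- The restriction of `σ` to `T d`. -/
def stageSigma (d : ℕ) : T d →+* T d where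
  toFun x := ⟨σ x.1, h.sigma_mem x.2⟩
  map_one' := Subtype.ext (map_one σ)
  map_zero' := Subtype.ext (map_zero σ)
  map_add' x y := Subtype.ext (map_add σ x.1 y.1)
  map_mul' x y := Subtype.ext (map_mul σ x.1 y.1)

/-- The inclusion of `T d` into `T (d + 1)`. -/
def stageIncl (d : ℕ) : T d →+* T (d + 1) :=
  (Subalgebra.inclusion (h.mono (Nat.le_succ d))).toRingHom

/-- The derivation from `T d` to `T (d + 1)`. -/
def stageDel (d : ℕ) : T d →+ T (d + 1) where
  toFun x := ⟨δ x.1, h.del_mem x.2⟩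
  map_zero' := Subtype.ext (map_zero δ)
  map_add' x y := Subtype.ext (map_add δ x.1 y.1)

theorem stageDel_mul (d : ℕ) (x y : T d) : h.stageDel d (x * y) =
    h.stageIncl d x * h.stageDel d y + h.stageIncl d y * h.stageDel d x :=
  Subtype.ext (δ.leibniz x.1 y.1)

theorem stageIncl_stageSigma (d : ℕ) (x : T d) :
    h.stageIncl d (h.stageSigma d x) = h.stageSigma (d + 1) (h.stageIncl d x) :=
  rfl

theorem stageDel_stageSigma (d : ℕ) (x : T d) :
    h.stageDel d (h.stageSigma d x) = h.stageSigma (d + 1) (h.stageDel d x) :=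
  Subtype.ext (h.sigma_del x.1).symm

/-- `I' ⊇ I ∪ ∂I` for ideals `I` and `I'` of `∂`-polynomials of order `< d` and `< d + 1`. -/
def IsProlongation {d : ℕ} (I : Ideal (T d)) (I' : Ideal (T (d + 1))) : Prop :=
  ∀ x ∈ I, h.stageIncl d x ∈ I' ∧ h.stageDel d x ∈ I'

/-- The derivation `D` of `L` extends `φ` to `ψ` with `ψ ∘ ∂ = D ∘ φ` on `T (d + 1)`. Since `φ`
kills `I'`, `ψ` kills both `I'` and `∂I'`, so these generate a proper ideal; it is `σ`-stable
because `σ` and `∂` commute. -/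
theorem exists_prolongation [CharZero F] {d : ℕ}
    {I : Ideal (T d)} {I' : Ideal (T (d + 1))}
    (hI : I.IsMaximalStable (h.stageSigma d)) (hI' : I'.IsMaximalStable (h.stageSigma (d + 1)))
    (hp : h.IsProlongation I I') :
    ∃ I'' : Ideal (T (d + 1 + 1)),
      I''.IsMaximalStable (h.stageSigma (d + 1 + 1)) ∧ h.IsProlongation I' I'' := by
  let : Algebra ℚ (T (d + 1)) :=
    ((algebraMap F (T (d + 1))).comp (algebraMap ℚ F)).toAlgebra
  obtain ⟨L, _, φ, D, hφ, hD⟩ := exists_field_derivation (h.stageIncl d) (h.stageDel d)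
    (h.stageDel_mul d) hI.isRadical hI.ne_top
    (hI.comap_eq (h.stageIncl d) (h.stageIncl_stageSigma d) hI'.stable hI'.ne_top
      fun x hx => (hp x hx).1) fun x hx => (hp x hx).2
  obtain ⟨ψ, hψ⟩ := h.exists_extension d L φ D fun x hx => hD ⟨x, hx⟩
  let s : Set (T (d + 1 + 1)) :=
    h.stageIncl (d + 1) '' I' ∪ h.stageDel (d + 1) '' I'
  have hs : Ideal.span s ≠ ⊤ := by
    have : Ideal.span s ≤ RingHom.ker (ψ.comp ((T (d + 1 + 1)).val : T (d + 1 + 1) →+* S)) := by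
      rw [Ideal.span_le]
      rintro _ (⟨x, hx, rfl⟩ | ⟨x, hx, rfl⟩)
      · rw [SetLike.mem_coe, RingHom.mem_ker]
        exact (hψ x.1 x.2).1.trans (hφ x hx)
      · rw [SetLike.mem_coe, RingHom.mem_ker]
        exact (hψ x.1 x.2).2.trans (by rw [hφ x hx, map_zero])
    exact ne_top_of_le_ne_top (RingHom.ker_ne_top _) this
  have hs' : Ideal.span s ≤ (Ideal.span s).comap (h.stageSigma (d + 1 + 1)) := by
    rw [Ideal.span_le]
    rintro _ (⟨x, hx, rfl⟩ | ⟨x, hx, rfl⟩)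
    · refine Ideal.subset_span (.inl ⟨_, hI'.stable hx, h.stageIncl_stageSigma _ x⟩)
    · refine Ideal.subset_span (.inr ⟨_, hI'.stable hx, h.stageDel_stageSigma _ x⟩)
  obtain ⟨I'', hle, hI''⟩ := Ideal.exists_le_isMaximalStable _ _ hs hs'
  exact ⟨I'', hI'', fun x hx => ⟨hle (Ideal.subset_span (.inl ⟨x, hx, rfl⟩)),
    hle (Ideal.subset_span (.inr ⟨x, hx, rfl⟩))⟩⟩

theorem isMaximalStable_bot [Nontrivial S] :
    (⊥ : Ideal (T 0)).IsMaximalStable (h.stageSigma 0) := by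
  have hf : IsField (T 0) :=
    (((Subalgebra.equivOfEq _ _ h.zero_eq_bot).trans (Algebra.botEquiv F _)).toMulEquiv).isField
      (Field.toIsField F)
  let := hf.toField
  exact ⟨bot_ne_top, by simp, fun I _ _ => eq_bot_or_eq_top I⟩

theorem exists_seq_isProlongation [CharZero F] [Nontrivial S]
    (I₁ : Ideal (T 1)) (h₁ : I₁ ≠ ⊤) (h₁' : I₁ ≤ I₁.comap (h.stageSigma 1)) :
    ∃ I : ∀ d, Ideal (T d), (∀ d, (I d).IsMaximalStable (h.stageSigma d)) ∧
      (∀ d, h.IsProlongation (I d) (I (d + 1))) ∧ I₁ ≤ I 1 := by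
  obtain ⟨M, hle, hM⟩ := Ideal.exists_le_isMaximalStable _ I₁ h₁ h₁'
  -- Each prolongation needs two consecutive ideals, so the recursion carries overlapping pairs. It
  -- starts at `(⊥, M)`, where the condition on derivatives is vacuous since `T 0 = F`.
  let U : ℕ → Type _ := fun d => {P : Ideal (T d) × Ideal (T (d + 1)) //
    P.1.IsMaximalStable (h.stageSigma d) ∧ P.2.IsMaximalStable (h.stageSigma (d + 1)) ∧
      h.IsProlongation P.1 P.2}
  have step : ∀ d (P : U d), ∃ Q : U (d + 1), Q.1.1 = P.1.2 := by
    rintro d ⟨P, h1, h2, h3⟩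
    obtain ⟨I'', h4, h5⟩ := h.exists_prolongation h1 h2 h3
    exact ⟨⟨(P.2, I''), h2, h4, h5⟩, rfl⟩
  choose next hnext using step
  let t₀ : U 0 := ⟨(⊥, M), h.isMaximalStable_bot, hM, by
    rintro x rfl
    simp⟩
  let t : ∀ d, U d := fun d => Nat.rec t₀ next d
  have ht : ∀ d, (t (d + 1)).1.1 = (t d).1.2 := fun d => hnext d (t d)
  refine ⟨fun d => (t d).1.1, fun d => (t d).2.1, fun d => ?_, ?_⟩
  · change h.IsProlongation (t d).1.1 (t (d + 1)).1.1
    rw [ht]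
    exact (t d).2.2.2
  · change I₁ ≤ (t (0 + 1)).1.1
    rw [ht]
    exact hle

/-- A proper `σ`-ideal `J` gives rise to a `∂`-ideal of `S` that is maximal among the proper
`σ`-ideals and contains `J ∩ T 1`. -/
theorem exists_isMaximalStable_del_stable [CharZero F] [Nontrivial S] (J : Ideal S) (hJ : J ≠ ⊤)
    (hJσ : J ≤ J.comap σ) :
    ∃ m : Ideal S, m.IsMaximalStable σ ∧ (∀ x ∈ m, δ x ∈ m) ∧ ∀ x ∈ J, x ∈ T 1 → x ∈ m := by
  obtain ⟨I, hI, hp, hle⟩ := h.exists_seq_isProlongation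
    (J.comap ((T 1).val : T 1 →+* S)) (by rwa [Ne, Ideal.comap_eq_top_iff]) fun x hx => hJσ hx
  have hmono : ∀ {d e x} (_ : d ≤ e) (hx : x ∈ T d) (he : x ∈ T e),
      (⟨x, hx⟩ : T d) ∈ I d → (⟨x, he⟩ : T e) ∈ I e := by
    intro d e x hde hx he hxI
    induction e, hde using Nat.le_induction with
    | base => exact hxI
    | succ e hde ih => exact (hp e _ (ih (h.mono hde hx))).1
  let m : Ideal S :=
    { carrier := {x | ∃ d, ∃ hx : x ∈ T d, (⟨x, hx⟩ : T d) ∈ I d}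
      zero_mem' := ⟨0, zero_mem _, (I 0).zero_mem⟩
      add_mem' := by
        rintro x y ⟨d, hx, hx'⟩ ⟨e, hy, hy'⟩
        have hx2 := h.mono (le_max_left d e) hx
        have hy2 := h.mono (le_max_right d e) hy
        exact ⟨max d e, add_mem hx2 hy2, (I _).add_mem (hmono (le_max_left d e) hx hx2 hx')
          (hmono (le_max_right d e) hy hy2 hy')⟩
      smul_mem' := by
        rintro c x ⟨d, hx, hx'⟩
        obtain ⟨e, hc⟩ := h.exists_mem c
        have hx2 := h.mono (le_max_left d e) hx
        have hc2 := h.mono (le_max_right d e) hc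
        exact ⟨max d e, mul_mem hc2 hx2,
          (I _).mul_mem_left ⟨c, hc2⟩ (hmono (le_max_left d e) hx hx2 hx')⟩ }
  refine ⟨m, ⟨?_, ?_, ?_⟩, ?_, fun x hx hx1 => ⟨1, hx1, hle hx⟩⟩
  · rw [Ideal.ne_top_iff_one]
    rintro ⟨d, hx, hxI⟩
    exact (hI d).ne_top ((Ideal.eq_top_iff_one _).2 hxI)
  · rintro x ⟨d, hx, hxI⟩
    exact ⟨d, h.sigma_mem hx, (hI d).stable hxI⟩
  · intro K hK hmK
    by_cases hKt : K = ⊤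
    · exact .inr hKt
    refine .inl (le_antisymm (fun x hx => ?_) hmK)
    obtain ⟨d, hd⟩ := h.exists_mem x
    -- A proper `σ`-ideal `K ⊇ m` meets each `T d` exactly in `I d`.
    have := (hI d).comap_eq ((T d).val : T d →+* S) (τ := σ) (fun y => rfl) hK hKt
      fun y hy => hmK ⟨d, y.2, hy⟩
    refine ⟨d, hd, ?_⟩
    rw [← this]
    exact hx
  · rintro x ⟨d, hx, hxI⟩
    exact ⟨d + 1, h.del_mem hx, (hp d _ hxI).2⟩

end IsDelFiltration

/-! ### Differential polynomials -/

namespace DelPolynomial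

open MvPolynomial

variable {F : Type u} [Field F] {J : Type}

/-- The subalgebra of `∂`-polynomials of order `< d`. -/
noncomputable def stage (F : Type u) [Field F] (J : Type) (d : ℕ) :
    Subalgebra F (MvPolynomial (ℕ × J) F) :=
  supported F {p : ℕ × J | p.1 < d}

theorem stage_mono {d e : ℕ} (h : d ≤ e) : stage F J d ≤ stage F J e :=
  supported_mono fun _ hp => lt_of_lt_of_le hp h

theorem X_mem_stage {d : ℕ} {p : ℕ × J} (h : p.1 < d) :
    (X p : MvPolynomial (ℕ × J) F) ∈ stage F J d :=
  X_mem_supported.2 h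

theorem exists_mem_stage (x : MvPolynomial (ℕ × J) F) : ∃ d, x ∈ stage F J d := by
  induction x using MvPolynomial.induction_on with
  | C a => exact ⟨0, Subalgebra.algebraMap_mem _ a⟩
  | add p q hp hq =>
    obtain ⟨d, hd⟩ := hp
    obtain ⟨e, he⟩ := hq
    exact ⟨max d e, add_mem (stage_mono (le_max_left _ _) hd) (stage_mono (le_max_right _ _) he)⟩
  | mul_X p i hp =>
    obtain ⟨d, hd⟩ := hp
    exact ⟨max d (i.1 + 1), mul_mem (stage_mono (le_max_left _ _) hd)
      (stage_mono (le_max_right _ _) (X_mem_stage (Nat.lt_succ_self _)))⟩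

variable [SigmaDelRing F]

/-- The derivation of `F[X, ∂X, ∂²X, …]`, viewed as a homomorphism to the dual numbers; the
variable `X (k, j)` stands for `∂ᵏ X_j`. -/
noncomputable def dualHom (F : Type u) [Field F] [SigmaDelRing F] (J : Type) :
    MvPolynomial (ℕ × J) F →+*
      TrivSqZeroExt (MvPolynomial (ℕ × J) F) (MvPolynomial (ℕ × J) F) :=
  eval₂Hom (TrivSqZeroExt.ringHomOfLeibniz C
      ((C : F →+* MvPolynomial (ℕ × J) F).toAddMonoidHom.comp
        (Differential.deriv (R := F)).toLinearMap.toAddMonoidHom)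
      fun x y => by simp)
    fun p => TrivSqZeroExt.inl (X p) + TrivSqZeroExt.inr (X (p.1 + 1, p.2))

theorem dualHom_C (a : F) : dualHom F J (C a) =
    TrivSqZeroExt.inl (C a) + TrivSqZeroExt.inr (C (Differential.deriv a)) := by
  simp [dualHom, TrivSqZeroExt.ringHomOfLeibniz]

theorem dualHom_X (p : ℕ × J) : dualHom F J (X p) =
    TrivSqZeroExt.inl (X p) + TrivSqZeroExt.inr (X (p.1 + 1, p.2)) := by
  simp [dualHom]

theorem fst_dualHom (x : MvPolynomial (ℕ × J) F) : (dualHom F J x).fst = x := by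
  induction x using MvPolynomial.induction_on with
  | C a => simp [dualHom_C]
  | add p q hp hq => simp [hp, hq]
  | mul_X p i hp => simp [hp, dualHom_X]

/-- The derivation of the ring of `∂`-polynomials over `F` in the variables `J`. -/
noncomputable def del (F : Type u) [Field F] [SigmaDelRing F] (J : Type) :
    Derivation ℤ (MvPolynomial (ℕ × J) F) (MvPolynomial (ℕ × J) F) :=
  .ofLeibniz ((TrivSqZeroExt.sndHom _ _).toAddMonoidHom.comp (dualHom F J).toAddMonoidHom)
    fun a b => by simp [fst_dualHom, mul_comm]

theorem del_apply (x : MvPolynomial (ℕ × J) F) : del F J x = (dualHom F J x).snd := rfl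

@[simp] theorem del_C (a : F) : del F J (C a) = C (Differential.deriv a) := by
  simp [del_apply, dualHom_C]

@[simp] theorem del_X (p : ℕ × J) : del F J (X p) = X (p.1 + 1, p.2) := by
  simp [del_apply, dualHom_X]

/-- The endomorphism `σ` of the ring of `∂`-polynomials with `σ X_j = g j`. -/
noncomputable def sigma (g : J → MvPolynomial (ℕ × J) F) :
    MvPolynomial (ℕ × J) F →+* MvPolynomial (ℕ × J) F :=
  eval₂Hom (C.comp (SigmaDelRing.sigma : F ≃+* F).toRingHom) fun p => (del F J)^[p.1] (g p.2)

variable (g : J → MvPolynomial (ℕ × J) F)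

@[simp] theorem sigma_C (a : F) : sigma g (C a) = C (SigmaDelRing.sigma a) := by
  simp [sigma]

@[simp] theorem sigma_X (p : ℕ × J) : sigma g (X p) = (del F J)^[p.1] (g p.2) := by
  simp [sigma]

theorem sigma_del (x : MvPolynomial (ℕ × J) F) : sigma g (del F J x) = del F J (sigma g x) := by
  induction x using MvPolynomial.induction_on with
  | C a => simp [SigmaDelRing.sigma_deriv]
  | add p q hp hq => simp [hp, hq]
  | mul_X p i hp => simp [hp, Function.iterate_succ_apply']

theorem del_mem_stage {d : ℕ} {x : MvPolynomial (ℕ × J) F} (hx : x ∈ stage F J d) :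
    del F J x ∈ stage F J (d + 1) := by
  have hle : stage F J d ≤ stage F J (d + 1) := stage_mono (Nat.le_succ d)
  induction hx using Algebra.adjoin_induction with
  | mem x hx =>
    obtain ⟨p, hp, rfl⟩ := hx
    rw [del_X]
    exact X_mem_stage (Nat.succ_lt_succ hp)
  | algebraMap a =>
    rw [algebraMap_eq, del_C]
    exact Subalgebra.algebraMap_mem _ _
  | add x y hx hy hx' hy' => rw [map_add]; exact add_mem hx' hy'
  | mul x y hx hy hx' hy' =>
    rw [Derivation.leibniz]
    exact add_mem (mul_mem (hle hx) hy') (mul_mem (hle hy) hx')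

variable {g}

theorem sigma_mem_stage (hg : ∀ j, g j ∈ stage F J 1) {d : ℕ} {x : MvPolynomial (ℕ × J) F}
    (hx : x ∈ stage F J d) : sigma g x ∈ stage F J d := by
  induction hx using Algebra.adjoin_induction with
  | mem x hx =>
    obtain ⟨p, hp, rfl⟩ := hx
    rw [sigma_X]
    have : ∀ k, (del F J)^[k] (g p.2) ∈ stage F J (k + 1) := fun k => by
      induction k with
      | zero => exact hg _
      | succ k ih => rw [Function.iterate_succ_apply']; exact del_mem_stage ih
    exact stage_mono hp (this p.1)
  | algebraMap a =>
    rw [algebraMap_eq, sigma_C]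
    exact Subalgebra.algebraMap_mem _ _
  | add x y hx hy hx' hy' => rw [map_add]; exact add_mem hx' hy'
  | mul x y hx hy hx' hy' => rw [map_mul]; exact mul_mem hx' hy'

/-- A homomorphism from `∂`-polynomials of order `≤ d` to `L` extends to all `∂`-polynomials,
with prescribed behaviour on the derivatives of the elements of order `≤ d`. -/
theorem exists_ringHom_extension {L : Type w} [CommRing L] (d : ℕ) (φ : stage F J (d + 1) →+* L)
    (D : Derivation ℤ L L)
    (hD : ∀ x (hx : x ∈ stage F J d), D (φ ⟨x, stage_mono (Nat.le_succ d) hx⟩) =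
      φ ⟨del F J x, del_mem_stage hx⟩) :
    ∃ ψ : MvPolynomial (ℕ × J) F →+* L, ∀ x (hx : x ∈ stage F J (d + 1)),
      ψ x = φ ⟨x, hx⟩ ∧ ψ (del F J x) = D (φ ⟨x, hx⟩) := by
  classical
  let ψ : MvPolynomial (ℕ × J) F →+* L :=
    eval₂Hom (φ.comp (algebraMap F (stage F J (d + 1)))) fun p =>
      if h : p.1 < d + 1 then φ ⟨X p, X_mem_stage h⟩
      -- This value is forced in order `d + 1`; in higher orders it is arbitrary, since these
      -- variables do not occur in the claim.
      else D (φ ⟨X (d, p.2), X_mem_stage (Nat.lt_succ_self d)⟩)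
  have hC : ∀ a, ψ (C a) = φ (algebraMap F (stage F J (d + 1)) a) := fun a => by simp [ψ]
  have hψ : ∀ x (hx : x ∈ stage F J (d + 1)), ψ x = φ ⟨x, hx⟩ := by
    intro x hx
    induction hx using Algebra.adjoin_induction with
    | mem x hx =>
      obtain ⟨p, hp, rfl⟩ := hx
      have hp' : p.1 < d + 1 := hp
      simp only [ψ, coe_eval₂Hom, eval₂_X, dif_pos hp']
    | algebraMap a => exact hC a
    | add x y hx hy hx' hy' => rw [map_add, hx', hy', ← map_add]; rfl
    | mul x y hx hy hx' hy' => rw [map_mul, hx', hy', ← map_mul]; rfl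
  have h2 : ∀ x (hx : x ∈ stage F J d), ψ (del F J x) = D (φ ⟨x, stage_mono (Nat.le_succ d) hx⟩) :=
    fun x hx => (hψ _ (del_mem_stage hx)).trans (hD x hx).symm
  -- Both `ψ ∘ ∂` and `D ∘ φ` are derivations along `φ`, so generators suffice: `hD` covers order `<
  -- d`, the choice of `ψ` covers order `d`.
  refine ⟨ψ, fun x hx => ⟨hψ x hx, ?_⟩⟩
  induction hx using Algebra.adjoin_induction with
  | mem x hx =>
    obtain ⟨p, hp, rfl⟩ := hx
    rcases (Nat.lt_succ_iff_lt_or_eq.1 hp) with h | h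
    · exact h2 _ (X_mem_stage h)
    · obtain ⟨k, j⟩ := p
      obtain rfl : k = d := h
      simp [ψ]
  | algebraMap a => exact h2 _ (Subalgebra.algebraMap_mem _ a)
  | add x y hx hy hx' hy' => rw [map_add, map_add, hx', hy', ← map_add, ← map_add]; rfl
  | mul x y hx hy hx' hy' =>
    have : (⟨x * y, mul_mem hx hy⟩ : stage F J (d + 1)) = ⟨x, hx⟩ * ⟨y, hy⟩ := rfl
    rw [this]
    simp only [Derivation.leibniz, map_add, map_mul, smul_eq_mul, hx', hy', hψ _ hx, hψ _ hy]

theorem isDelFiltration (hg : ∀ j, g j ∈ stage F J 1) :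
    IsDelFiltration (sigma g) (del F J) (stage F J) where
  mono _ _ h := stage_mono h
  exists_mem := exists_mem_stage
  zero_eq_bot := by simp [stage]
  sigma_del := sigma_del g
  sigma_mem := sigma_mem_stage hg
  del_mem := del_mem_stage
  exists_extension d L _ φ D hD := exists_ringHom_extension d φ D hD

end DelPolynomial

/-! ### Quotients by `∂`-stable maximal `σ`-ideals -/

/-- The derivation induced on the quotient by an ideal stable under a derivation. -/
def Derivation.quotientMap {S : Type u} [CommRing S] (δ : Derivation ℤ S S) (m : Ideal S)
    (h : ∀ x ∈ m, δ x ∈ m) : Derivation ℤ (S ⧸ m) (S ⧸ m) :=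
  .ofLeibniz (QuotientAddGroup.map m.toAddSubgroup m.toAddSubgroup δ.toLinearMap.toAddMonoidHom h :
    S ⧸ m →+ S ⧸ m) (by
      intro a b
      obtain ⟨a, rfl⟩ := Ideal.Quotient.mk_surjective a
      obtain ⟨b, rfl⟩ := Ideal.Quotient.mk_surjective b
      exact congrArg (Ideal.Quotient.mk m) (δ.leibniz a b))

theorem Ideal.IsMaximalStable.quotientMap_injective {S : Type u} [CommRing S] {σ : S →+* S}
    {m : Ideal S} (hm : m.IsMaximalStable σ) :
    Function.Injective (Ideal.quotientMap m σ hm.stable) :=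
  Ideal.quotientMap_injective' (hm.comap_eq σ (fun _ => rfl) hm.stable hm.ne_top hm.stable).le

/-- The `(σ, ∂)`-structure on the quotient by a `∂`-stable maximal `σ`-ideal. -/
noncomputable abbrev Ideal.IsMaximalStable.sigmaDelRing {S : Type u} [CommRing S] {σ : S →+* S}
    {m : Ideal S} (hm : m.IsMaximalStable σ) (δ : Derivation ℤ S S) (hδ : ∀ x ∈ m, δ x ∈ m)
    (hσδ : ∀ x, σ (δ x) = δ (σ x))
    (hs : Function.Surjective (Ideal.quotientMap m σ hm.stable)) : SigmaDelRing (S ⧸ m) where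
  deriv := δ.quotientMap m hδ
  sigma := RingEquiv.ofBijective _ ⟨hm.quotientMap_injective, hs⟩
  sigma_deriv x := by
    obtain ⟨x, rfl⟩ := Ideal.Quotient.mk_surjective x
    exact congrArg (Ideal.Quotient.mk m) (hσδ x)

theorem Ideal.IsMaximalStable.isSimpleSigmaRing {S : Type u} [CommRing S] {σ : S →+* S}
    {m : Ideal S} (hm : m.IsMaximalStable σ) [SigmaDelRing (S ⧸ m)]
    (h : ∀ x, SigmaDelRing.sigma (Ideal.Quotient.mk m x) = Ideal.Quotient.mk m (σ x)) :
    IsSimpleSigmaRing (S ⧸ m) where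
  nontrivial := Ideal.Quotient.nontrivial_iff.2 hm.ne_top
  eq_bot_or_eq_top I hI := by
    have hinj := Ideal.comap_injective_of_surjective _ (Ideal.Quotient.mk_surjective (I := m))
    have hle : m ≤ I.comap (Ideal.Quotient.mk m) := fun x hx => by
      rw [Ideal.mem_comap, Ideal.Quotient.eq_zero_iff_mem.2 hx]
      exact I.zero_mem
    refine (hm.eq_or_eq_top (I.comap (Ideal.Quotient.mk m)) (fun x hx => ?_) hle).imp
      (fun h => hinj ?_) fun h => hinj (by rw [h, Ideal.comap_top])
    · rw [Ideal.mem_comap, Ideal.mem_comap, ← h]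
      exact hI _ hx
    · rw [h, ← RingHom.ker_eq_comap_bot, Ideal.mk_ker]

/-! ### The system `σ(Y) = A Y` -/

namespace DelPolynomial

open MvPolynomial

variable {F : Type u} [Field F] {n : ℕ}

/-- The matrix of the unknowns. -/
noncomputable def genericMatrix (F : Type u) [Field F] (n : ℕ) :
    Matrix (Fin n) (Fin n) (MvPolynomial (ℕ × Option (Fin n × Fin n)) F) :=
  Matrix.of fun i k => X (0, some (i, k))

/-- The images under `σ` of the unknowns for the system `σ(Y) = A Y`; the last unknown stands for
`1 / det Y`. -/
noncomputable def systemRhs (A : Matrix (Fin n) (Fin n) F) :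
    Option (Fin n × Fin n) → MvPolynomial (ℕ × Option (Fin n × Fin n)) F
  | none => C A.det⁻¹ * X (0, none)
  | some (i, k) => ∑ l, C (A i l) * X (0, some (l, k))

theorem systemRhs_mem_stage (A : Matrix (Fin n) (Fin n) F) (j : Option (Fin n × Fin n)) :
    systemRhs A j ∈ stage F _ 1 := by
  have hC : ∀ a : F, C a ∈ stage F (Option (Fin n × Fin n)) 1 :=
    fun a => Subalgebra.algebraMap_mem _ a
  rcases j with _ | ⟨i, k⟩
  · exact mul_mem (hC _) (X_mem_stage Nat.one_pos)
  · exact sum_mem fun l _ => mul_mem (hC _) (X_mem_stage Nat.one_pos)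

/-- The relation expressing that the last unknown is `1 / det Y`. -/
noncomputable def detRelation (F : Type u) [Field F] (n : ℕ) :
    MvPolynomial (ℕ × Option (Fin n × Fin n)) F :=
  X (0, none) * (genericMatrix F n).det - 1

theorem detRelation_mem_stage : detRelation F n ∈ stage F _ 1 := by
  refine sub_mem (mul_mem (X_mem_stage Nat.one_pos) ?_) (one_mem _)
  rw [Matrix.det_apply]
  exact sum_mem fun s _ => Subalgebra.zsmul_mem _ (prod_mem fun i _ => X_mem_stage Nat.one_pos) _

theorem span_detRelation_ne_top : Ideal.span {detRelation F n} ≠ ⊤ := by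
  -- Evaluation at `Y = 1` and `1 / det Y = 1`. It need not respect `∂`, so variables of every order
  -- receive the same values.
  let e : MvPolynomial (ℕ × Option (Fin n × Fin n)) F →+* F :=
    eval₂Hom (RingHom.id F) fun p => p.2.elim 1 fun q => if q.1 = q.2 then 1 else 0
  have h1 : e.mapMatrix (genericMatrix F n) = 1 := by
    ext i k
    simp [e, genericMatrix, Matrix.one_apply]
  have h2 : Ideal.span {detRelation F n} ≤ RingHom.ker e := by
    rw [Ideal.span_singleton_le_iff_mem, RingHom.mem_ker, detRelation, map_sub, map_mul,
      RingHom.map_det, h1]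
    simp [e]
  exact ne_top_of_le_ne_top (RingHom.ker_ne_top _) h2

variable [SigmaDelRing F]

theorem sigma_genericMatrix (A : Matrix (Fin n) (Fin n) F) :
    (genericMatrix F n).map (sigma (systemRhs A)) = A.map C * genericMatrix F n := by
  ext1 i k
  simp [genericMatrix, systemRhs, Matrix.mul_apply]

/-- The factors `det A` and its inverse cancel; invariance makes the ideal of the relation a
`σ`-ideal. -/
theorem sigma_detRelation {A : Matrix (Fin n) (Fin n) F} (hA : A.det ≠ 0) :
    sigma (systemRhs A) (detRelation F n) = detRelation F n := by
  have h1 : (sigma (systemRhs A)) (genericMatrix F n).det =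
      C A.det * (genericMatrix F n).det := by
    rw [RingHom.map_det, RingHom.mapMatrix_apply, sigma_genericMatrix, Matrix.det_mul,
      RingHom.map_det, RingHom.mapMatrix_apply]
  rw [detRelation, map_sub, map_mul, h1, map_one, sigma_X]
  simp only [Function.iterate_zero, id_eq, systemRhs]
  rw [mul_mul_mul_comm, mul_comm, ← mul_assoc, mul_assoc, ← C_mul, inv_mul_cancel₀ hA, C_1,
    mul_one, mul_comm]

/-- The range of the induced `σ` is a subring. It contains the image of `F`, where `σ` is bijective,
and the unknowns, since `Y = A⁻¹ σ(Y)` and `1 / det Y = det A * σ(1 / det Y)`. It is closed under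
`∂` because `σ` and `∂` commute. -/
theorem quotientMap_sigma_surjective {A : Matrix (Fin n) (Fin n) F} (hA : A.det ≠ 0)
    {m : Ideal (MvPolynomial (ℕ × Option (Fin n × Fin n)) F)}
    (hm : m.IsMaximalStable (sigma (systemRhs A))) (hδ : ∀ x ∈ m, del F _ x ∈ m) :
    Function.Surjective (Ideal.quotientMap m (sigma (systemRhs A)) hm.stable) := by
  let τ := Ideal.quotientMap m (sigma (systemRhs A)) hm.stable
  let π := Ideal.Quotient.mk m
  have hτ : ∀ x, τ (π x) = π (sigma (systemRhs A) x) := fun x => rfl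
  have hC : ∀ a, π (C a) ∈ τ.range := fun a => ⟨π (C (SigmaDelRing.sigma.symm a)), by
    rw [hτ, sigma_C, RingEquiv.apply_symm_apply]⟩
  have hX : ∀ k j, π (X (k, j)) ∈ τ.range := by
    intro k j
    induction k with
    | succ k ih =>
      obtain ⟨y, hy⟩ := ih
      obtain ⟨y, rfl⟩ := Ideal.Quotient.mk_surjective y
      refine ⟨π (del F _ y), ?_⟩
      have h := congrArg ((del F _).quotientMap m hδ) hy
      rw [hτ, sigma_del]
      exact h.trans (congrArg π (del_X (k, j)))
    | zero =>
      rcases j with _ | ⟨i, k⟩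
      · have : π (X (0, none)) = π (C A.det) * τ (π (X (0, none))) := by
          rw [hτ, ← map_mul, sigma_X]
          simp only [Function.iterate_zero, id_eq, systemRhs]
          rw [← mul_assoc, ← C_mul, mul_inv_cancel₀ hA, C_1, one_mul]
        rw [this]
        exact mul_mem (hC _) ⟨_, rfl⟩
      · have h : genericMatrix F n =
            A⁻¹.map C * (genericMatrix F n).map (sigma (systemRhs A)) := by
          rw [sigma_genericMatrix, ← Matrix.mul_assoc, ← Matrix.map_mul,
            Matrix.nonsing_inv_mul A hA.isUnit, Matrix.map_one _ C_0 C_1, Matrix.one_mul]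
        have h' : π (X (0, some (i, k))) = ∑ l, π (C (A⁻¹ i l)) * τ (π (genericMatrix F n l k)) := by
          refine (congrArg π (congrFun (congrFun h i) k)).trans ?_
          simp only [Matrix.mul_apply, map_sum, map_mul, Matrix.map_apply, hτ]
        rw [h']
        exact sum_mem fun l _ => mul_mem (hC _) ⟨_, rfl⟩
  intro x
  obtain ⟨x, rfl⟩ := Ideal.Quotient.mk_surjective x
  change π x ∈ τ.range
  induction x using MvPolynomial.induction_on with
  | C a => exact hC a
  | add p q hp hq => rw [map_add]; exact add_mem hp hq
  | mul_X p i hp => rw [map_mul]; exact mul_mem hp (hX i.1 i.2)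

theorem delAdjoin_eq_top {J : Type} {m : Ideal (MvPolynomial (ℕ × J) F)}
    [SigmaDelRing (MvPolynomial (ℕ × J) F ⧸ m)]
    (hδ : ∀ x, Differential.deriv (Ideal.Quotient.mk m x) = Ideal.Quotient.mk m (del F J x))
    {s : Set (MvPolynomial (ℕ × J) F ⧸ m)} (hs : ∀ j, Ideal.Quotient.mk m (X (0, j)) ∈ s) :
    delAdjoin F s = ⊤ := by
  refine (sInf_eq_top (α := Subalgebra F (MvPolynomial (ℕ × J) F ⧸ m))).2 ?_
  rintro T ⟨hsT, hT⟩
  have hX : ∀ k j, Ideal.Quotient.mk m (X (k, j)) ∈ T := by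
    intro k j
    induction k with
    | zero => exact hsT (hs j)
    | succ k ih =>
      have := hT _ ih
      rwa [hδ, del_X] at this
  rw [eq_top_iff]
  rintro x -
  obtain ⟨x, rfl⟩ := Ideal.Quotient.mk_surjective x
  induction x using MvPolynomial.induction_on with
  | C a => exact T.algebraMap_mem a
  | add p q hp hq => rw [map_add]; exact add_mem hp hq
  | mul_X p i hp => rw [map_mul]; exact mul_mem hp (hX i.1 i.2)

end DelPolynomial

open MvPolynomial DelPolynomial in
theorem mainTheorem1 {F : Type u} [Field F] [CharZero F] [SigmaDelRing F]
    (n : ℕ) (A : GL (Fin n) F) :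
    ∃ (R : Type u) (_ : CommRing R) (_ : SigmaDelRing R) (_ : Algebra F R),
      IsSigmaDelExtension F R ∧
      (∃ Z : GL (Fin n) R,
        IsFundamentalSolution A Z ∧ delAdjoin F (entriesAndInvDet Z) = ⊤) ∧
      IsSimpleSigmaRing R := by
  have hA : A.val.det ≠ 0 := A.det_ne_zero
  -- Only the part of the ideal in `T 1` is guaranteed to lie in `m`; the determinant relation has
  -- order zero, so this suffices.
  obtain ⟨m, hm, hδ, hmJ⟩ := (isDelFiltration (g := systemRhs A.val)
    (systemRhs_mem_stage A.val)).exists_isMaximalStable_del_stable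
    (Ideal.span {detRelation F n}) span_detRelation_ne_top (by
      rw [Ideal.span_singleton_le_iff_mem, Ideal.mem_comap, sigma_detRelation hA]
      exact Ideal.mem_span_singleton_self _)
  let S := MvPolynomial (ℕ × Option (Fin n × Fin n)) F
  let π : S →+* S ⧸ m := Ideal.Quotient.mk m
  have hdet : π (X (0, none)) * ((genericMatrix F n).map π).det = 1 := by
    have h := Ideal.Quotient.eq_zero_iff_mem.2
      (hmJ _ (Ideal.mem_span_singleton_self _) detRelation_mem_stage)
    rw [detRelation, map_sub, map_mul, map_one, sub_eq_zero, RingHom.map_det] at h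
    exact h
  let inst : SigmaDelRing (S ⧸ m) := hm.sigmaDelRing (del F _) hδ (sigma_del _)
    (quotientMap_sigma_surjective hA hm hδ)
  have hsigma : ∀ x, SigmaDelRing.sigma (π x) = π (sigma (systemRhs A.val) x) := fun _ => rfl
  have hderiv : ∀ x, Differential.deriv (π x) = π (del F _ x) := fun _ => rfl
  have : Nontrivial (S ⧸ m) := Ideal.Quotient.nontrivial_iff.2 hm.ne_top
  let Z : GL (Fin n) (S ⧸ m) := Matrix.GeneralLinearGroup.mk'' ((genericMatrix F n).map π)
    (.of_mul_eq_one_right _ hdet)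
  refine ⟨S ⧸ m, inferInstance, inst, inferInstance,
    ⟨(algebraMap F (S ⧸ m)).injective, fun a => ?_, fun a => ?_⟩, ⟨Z, ?_, ?_⟩,
    hm.isSimpleSigmaRing hsigma⟩
  · exact (hsigma (C a)).trans (congrArg π (sigma_C _ a))
  · exact (hderiv (C a)).trans (congrArg π (del_C a))
  · have h := congrArg (fun M => M.map π) (sigma_genericMatrix A.val)
    simp only [Matrix.map_mul, Matrix.map_map] at h
    exact h
  · refine delAdjoin_eq_top hderiv ?_
    rintro (_ | ⟨i, k⟩)
    · right
      rw [Set.mem_singleton_iff]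
      exact (Units.inv_eq_of_mul_eq_one_left (u := Matrix.GeneralLinearGroup.det Z) hdet).symm
    · exact .inl ⟨i, k, rfl⟩
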